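/- Let $n,\ell\ge 1$, let $A_1,\dots,A_\ell$ be Hermitian $n\times n$ complex matrices, let $1<r\le 2$, and let $0<p_1,\dots,p_\ell\le 1$ be real numbers with $\sum_{i=1}^{\ell}p_i=1$. Then for every unitarily invariant norm $|||\cdot|||$ on the space $\mathcal M_n$ of $n\times n$ complex matrices, i.e. every norm with $|||UAV|||=|||A|||$ for all $A\in\mathcal M_n$ and all unitary $U,V\in\mathcal M_n$, $$\Big|\Big|\Big|\ \Big|\sum_{i=1}^{\ell}A_i\Big|^{r}\ \Big|\Big|\Big|\ \le\ \Big|\Big|\Big|\ \sum_{i=1}^{\ell}p_i^{-1}|A_i|^{r}\ \Big|\Big|\Big| ,$$ where $|A|=(A^*A)^{1/2}$ and $|A|^r$ is the $r$-th power of the positive semidefinite matrix $|A|$, defined by the functional calculus. -/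

import Mathlib

open scoped MatrixOrder

/-- A norm on the space of `n × n` complex matrices, given as a seminorm over `ℂ` which
vanishes only at `0`, is unitarily invariant if `N (U * A * V) = N A` for all matrices `A` and
all unitary matrices `U`, `V`. -/
structure IsUnitarilyInvariantNorm {n : ℕ} (N : Seminorm ℂ (Matrix (Fin n) (Fin n) ℂ)) :
    Prop where
  eq_zero_of_map_eq_zero : ∀ A : Matrix (Fin n) (Fin n) ℂ, N A = 0 → A = 0
  map_unitary_mul_mul_unitary : ∀ A U V : Matrix (Fin n) (Fin n) ℂ,
    U ∈ Matrix.unitaryGroup (Fin n) ℂ → V ∈ Matrix.unitaryGroup (Fin n) ℂ →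
      N (U * A * V) = N A

/-!
Let `X = ∑ i, A i`, let `Y = ∑ i, (p i)⁻¹ • |A i| ^ r`, and let `U` be a unitary matrix which
diagonalizes `X`, with real eigenvalues `x k`. Then `star U * |X| ^ r * U` is the diagonal matrix
with entries `|x k| ^ r`, and the argument has two parts.

* The diagonal of `star U * Y * U` dominates these entries. Indeed, for a real number `s` the graph
  of `t ↦ |t| ^ r` lies above a line through `(s, |s| ^ r)`, say of slope `c`. Taking `t = a / p` and
  using `p ^ (1 - r) ≤ p⁻¹`, which is where `r ≤ 2` enters, gives
  `p * |s| ^ r + c * (a - p * s) ≤ p⁻¹ * |a| ^ r`. By the functional calculus `a` may be replaced by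
  `A i`, and summation over `i` yields `|s| ^ r + c • (X - s) ≤ Y` in the Loewner order. For
  `s = x k`, the `k`-th diagonal entry of `X - s` in the eigenbasis vanishes.
* A unitarily invariant norm does not increase under the passage to the diagonal
  (`IsUnitarilyInvariantNorm.map_diagonal_diag_le`), since this is an average of conjugations by
  diagonal sign matrices; and it is monotone on nonnegative diagonal matrices
  (`IsUnitarilyInvariantNorm.map_diagonal_mono`), since a diagonal matrix with entries
  `e k * cos (θ k)` is the average of the products of `diagonal e` with two unitary diagonal
  matrices.
-/

open Matrix
open scoped ComplexOrder

/-- The line of slope `r * |s| ^ r / s` supports the graph of `|·| ^ r` at `s`. For `s = 0` the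
slope is `0`, by the convention for division by zero, and the line is the horizontal axis. -/
lemma Real.abs_rpow_add_mul_sub_le_abs_rpow {r : ℝ} (hr : 1 ≤ r) (s t : ℝ) :
    |s| ^ r + r * |s| ^ r / s * (t - s) ≤ |t| ^ r := by
  rcases eq_or_ne s 0 with rfl | hs
  · simp [Real.zero_rpow (by linarith : r ≠ 0), Real.rpow_nonneg]
  have hb := one_add_mul_self_le_rpow_one_add (s := |t| / |s| - 1) (p := r)
    (by linarith [div_nonneg (abs_nonneg t) (abs_nonneg s)]) hr
  rw [add_sub_cancel, Real.div_rpow (abs_nonneg _) (abs_nonneg _), ← abs_div] at hb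
  have hpos : 0 < |s| ^ r := Real.rpow_pos_of_pos (abs_pos.2 hs) r
  have h : 1 + r * (t / s - 1) ≤ |t| ^ r / |s| ^ r := by
    refine le_trans ?_ hb
    have := le_abs_self (t / s)
    gcongr
  rw [le_div_iff₀ hpos] at h
  refine le_of_eq_of_le ?_ h
  field_simp

lemma Real.mul_abs_rpow_add_le_inv_mul_abs_rpow {r p : ℝ} (hr1 : 1 ≤ r) (hr2 : r ≤ 2)
    (hp0 : 0 < p) (hp1 : p ≤ 1) (s a : ℝ) :
    p * |s| ^ r + r * |s| ^ r / s * (a - p * s) ≤ p⁻¹ * |a| ^ r := by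
  have h := mul_le_mul_of_nonneg_left
    (Real.abs_rpow_add_mul_sub_le_abs_rpow hr1 s (a / p)) hp0.le
  rw [abs_div, Real.div_rpow (abs_nonneg _) (abs_nonneg _), abs_of_pos hp0] at h
  have hpr : 0 < p ^ r := Real.rpow_pos_of_pos hp0 r
  have h2 : p ^ (2 : ℝ) ≤ p ^ r := Real.rpow_le_rpow_of_exponent_ge hp0 hp1 hr2
  rw [Real.rpow_two] at h2
  have h3 : p * (|a| ^ r / p ^ r) ≤ p⁻¹ * |a| ^ r := by
    have : p / p ^ r ≤ p⁻¹ := by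
      rw [div_le_iff₀ hpr, ← div_eq_inv_mul, le_div_iff₀ hp0]
      linarith
    calc p * (|a| ^ r / p ^ r) = p / p ^ r * |a| ^ r := by ring
      _ ≤ p⁻¹ * |a| ^ r := by gcongr
  refine le_trans (le_of_eq ?_) (h.trans h3)
  have : p * (a / p) = a := by field_simp
  linear_combination (-(r * |s| ^ r / s)) * this

lemma Matrix.IsHermitian.abs_rpow_eq_cfc {ι : Type*} [Fintype ι] [DecidableEq ι]
    {A : Matrix ι ι ℂ} (hA : A.IsHermitian) {r : ℝ} (hr : 0 ≤ r) :
    CFC.abs A ^ r = cfc (fun x : ℝ ↦ |x| ^ r) A := by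
  have hA' : IsSelfAdjoint A := hA
  rw [CFC.rpow_eq_cfc_real (CFC.abs_nonneg A), CFC.abs_eq_cfc_norm A hA',
    ← cfc_comp' (fun x : ℝ ↦ x ^ r) (fun x : ℝ ↦ ‖x‖) A
      (Real.continuous_rpow_const hr).continuousOn]
  rfl

/-- The scalar inequality `p * |s| ^ r + c * (a - p * s) ≤ p⁻¹ * |a| ^ r`, lifted to Hermitian
matrices by the functional calculus. -/
lemma Matrix.IsHermitian.smul_one_add_smul_sub_le {ι : Type*} [Fintype ι] [DecidableEq ι]
    {A : Matrix ι ι ℂ} (hA : A.IsHermitian) {r p : ℝ} (hr1 : 1 ≤ r) (hr2 : r ≤ 2)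
    (hp0 : 0 < p) (hp1 : p ≤ 1) (s : ℝ) :
    (p * |s| ^ r) • (1 : Matrix ι ι ℂ) + (r * |s| ^ r / s) • (A - (p * s) • (1 : Matrix ι ι ℂ)) ≤
      p⁻¹ • CFC.abs A ^ r := by
  have hA' : IsSelfAdjoint A := hA
  have hc : Continuous fun x : ℝ ↦ |x| ^ r :=
    (Real.continuous_rpow_const (by linarith)).comp continuous_abs
  have hc' : Continuous fun x : ℝ ↦ p⁻¹ • |x| ^ r := hc.const_smul p⁻¹
  rw [hA.abs_rpow_eq_cfc (by linarith), ← cfc_smul p⁻¹ _ A hc.continuousOn]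
  have h := cfc_mono (a := A)
    (f := fun x : ℝ ↦ p * |s| ^ r + r * |s| ^ r / s * (x - p * s))
    (g := fun x : ℝ ↦ p⁻¹ • |x| ^ r)
    (fun x _ ↦ Real.mul_abs_rpow_add_le_inv_mul_abs_rpow hr1 hr2 hp0 hp1 s x)
    (by fun_prop) hc'.continuousOn
  refine le_of_eq_of_le ?_ h
  rw [cfc_const_add _ _ _ (by fun_prop), cfc_const_mul _ _ _ (by fun_prop),
    cfc_sub _ _ _ (by fun_prop) (by fun_prop), cfc_id' ℝ A, cfc_const _ A]
  simp only [Algebra.algebraMap_eq_smul_one]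

lemma Matrix.diagonal_mem_unitaryGroup {ι : Type*} [Fintype ι] [DecidableEq ι] {d : ι → ℂ}
    (hd : ∀ i, ‖d i‖ = 1) : diagonal d ∈ unitaryGroup ι ℂ := by
  rw [mem_unitaryGroup_iff, star_eq_conjTranspose, diagonal_conjTranspose, diagonal_mul_diagonal,
    ← diagonal_one]
  congr 1
  ext i
  simp [Complex.mul_conj, Complex.normSq_eq_norm_sq, hd]

/-- The diagonal part of a matrix is its average under conjugation by diagonal sign matrices. -/
lemma Matrix.sum_sign_conj {ι : Type*} [Fintype ι] [DecidableEq ι] (M : Matrix ι ι ℂ) :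
    ∑ ε : ι → ℤˣ, diagonal (fun i ↦ ((ε i : ℤ) : ℂ)) * M * diagonal (fun i ↦ ((ε i : ℤ) : ℂ)) =
      (Fintype.card (ι → ℤˣ) : ℂ) • diagonal M.diag := by
  ext a b
  simp only [sum_apply, mul_diagonal, diagonal_mul, smul_apply, smul_eq_mul]
  have hsq (u : ℤˣ) : ((u : ℤ) : ℂ) * ((u : ℤ) : ℂ) = 1 := by
    rcases Int.units_eq_one_or u with rfl | rfl <;> simp
  rcases eq_or_ne a b with rfl | hab
  · simp [mul_right_comm _ (M a a), hsq]
  · rw [diagonal_apply_ne _ hab, mul_zero]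
    -- Flipping the sign at `a` negates every summand.
    have h := Equiv.sum_comp (Equiv.mulLeft (Pi.mulSingle a (-1) : ι → ℤˣ))
      fun ε ↦ ((ε a : ℤ) : ℂ) * M a b * ((ε b : ℤ) : ℂ)
    simp only [Equiv.coe_mulLeft, Pi.mul_apply, Pi.mulSingle_eq_same,
      Pi.mulSingle_eq_of_ne hab.symm, one_mul, neg_mul, Units.val_neg, Int.cast_neg,
      Finset.sum_neg_distrib] at h
    exact self_eq_neg.1 h.symm

namespace IsUnitarilyInvariantNorm

variable {n : ℕ} {N : Seminorm ℂ (Matrix (Fin n) (Fin n) ℂ)}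

lemma map_diagonal_diag_le (hN : IsUnitarilyInvariantNorm N) (M : Matrix (Fin n) (Fin n) ℂ) :
    N (diagonal M.diag) ≤ N M := by
  have hc : (0 : ℝ) < Fintype.card (Fin n → ℤˣ) := by exact_mod_cast Fintype.card_pos
  have h := congrArg N (sum_sign_conj M)
  rw [map_smul_eq_mul, Complex.norm_natCast] at h
  refine le_of_mul_le_mul_left (h.symm.le.trans ((Finset.le_sum_of_subadditive N (map_zero N).le
    (map_add_le_add N) _ _).trans ?_)) hc
  have hu (ε : Fin n → ℤˣ) : diagonal (fun i ↦ ((ε i : ℤ) : ℂ)) ∈ unitaryGroup (Fin n) ℂ :=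
    diagonal_mem_unitaryGroup fun i ↦ by rcases Int.units_eq_one_or (ε i) with h | h <;> simp [h]
  simp [hN.map_unitary_mul_mul_unitary _ _ _ (hu _) (hu _)]

lemma map_diagonal_mono (hN : IsUnitarilyInvariantNorm N) {d e : Fin n → ℝ} (hd : ∀ k, 0 ≤ d k)
    (hde : ∀ k, d k ≤ e k) :
    N (diagonal fun k ↦ (d k : ℂ)) ≤ N (diagonal fun k ↦ (e k : ℂ)) := by
  -- An angle with `d k = e k * cos (θ k)`; if `e k = 0`, then `d k = 0` and any angle will do.
  set θ : Fin n → ℝ := fun k ↦ Real.arccos (d k / e k)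
  have hθ (k) : d k = e k * Real.cos (θ k) := by
    rw [Real.cos_arccos (by linarith [div_nonneg (hd k) ((hd k).trans (hde k))])
      (div_le_one_of_le₀ (hde k) ((hd k).trans (hde k)))]
    rcases eq_or_ne (e k) 0 with h | h
    · simp [h, le_antisymm (h ▸ hde k) (hd k)]
    · field_simp
  have hu (φ : Fin n → ℝ) : diagonal (fun k ↦ Complex.exp (φ k * Complex.I)) ∈
      unitaryGroup (Fin n) ℂ :=
    diagonal_mem_unitaryGroup fun k ↦ Complex.norm_exp_ofReal_mul_I _
  have hn (φ : Fin n → ℝ) :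
      N (diagonal (fun k ↦ Complex.exp (φ k * Complex.I)) * diagonal fun k ↦ (e k : ℂ)) =
        N (diagonal fun k ↦ (e k : ℂ)) := by
    have := hN.map_unitary_mul_mul_unitary (diagonal fun k ↦ (e k : ℂ)) _ 1 (hu φ) (one_mem _)
    rwa [mul_one] at this
  have key : (2 : ℂ) • diagonal (fun k ↦ (d k : ℂ)) =
      diagonal (fun k ↦ Complex.exp (θ k * Complex.I)) * diagonal (fun k ↦ (e k : ℂ)) +
      diagonal (fun k ↦ Complex.exp ((-θ) k * Complex.I)) * diagonal (fun k ↦ (e k : ℂ)) := by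
    rw [diagonal_mul_diagonal, diagonal_mul_diagonal, diagonal_add, ← diagonal_smul]
    congr 1
    ext k
    simp only [Pi.smul_apply, smul_eq_mul, hθ k, Pi.neg_apply, Complex.ofReal_mul,
      Complex.ofReal_cos, Complex.ofReal_neg, Complex.cos]
    ring
  have h := (congrArg N key).le.trans (map_add_le_add N _ _)
  rw [map_smul_eq_mul, hn, hn, Complex.norm_ofNat] at h
  linarith

end IsUnitarilyInvariantNorm

theorem corollary2p9 (n l : ℕ) (A : Fin l → Matrix (Fin n) (Fin n) ℂ)
    (hA : ∀ i, (A i).IsHermitian) (r : ℝ) (hr1 : 1 < r) (hr2 : r ≤ 2)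
    (p : Fin l → ℝ) (hp0 : ∀ i, 0 < p i) (hp1 : ∀ i, p i ≤ 1) (hp : ∑ i, p i = 1)
    (N : Seminorm ℂ (Matrix (Fin n) (Fin n) ℂ)) (hN : IsUnitarilyInvariantNorm N) :
    N (CFC.abs (∑ i, A i) ^ r) ≤ N (∑ i, (p i)⁻¹ • CFC.abs (A i) ^ r) := by
  set X := ∑ i, A i
  set Y := ∑ i, (p i)⁻¹ • CFC.abs (A i) ^ r
  have hX : X.IsHermitian := isSelfAdjoint_sum _ fun i _ ↦ hA i
  have hXY (s : ℝ) : (|s| ^ r) • (1 : Matrix (Fin n) (Fin n) ℂ) +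
      (r * |s| ^ r / s) • (X - s • (1 : Matrix (Fin n) (Fin n) ℂ)) ≤ Y := by
    have h := Finset.sum_le_sum fun i (_ : i ∈ Finset.univ) ↦
      (hA i).smul_one_add_smul_sub_le hr1.le hr2 (hp0 i) (hp1 i) s
    rwa [Finset.sum_add_distrib, ← Finset.sum_smul, ← Finset.sum_mul, hp, one_mul,
      ← Finset.smul_sum, Finset.sum_sub_distrib, ← Finset.sum_smul, ← Finset.sum_mul, hp,
      one_mul] at h
  set U := hX.eigenvectorUnitary
  set x := hX.eigenvalues
  have hUU : star (U : Matrix (Fin n) (Fin n) ℂ) * U = 1 := Unitary.coe_star_mul_self U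
  have hXU : star (U : Matrix (Fin n) (Fin n) ℂ) * X * U = diagonal fun k ↦ (x k : ℂ) := by
    rw [hX.spectral_theorem, Unitary.conjStarAlgAut_apply]
    simp only [← mul_assoc]
    rw [hUU, one_mul, mul_assoc, hUU, mul_one]
    rfl
  set Z := star (U : Matrix (Fin n) (Fin n) ℂ) * Y * U with hZdef
  have hZ (k) : ((|x k| ^ r : ℝ) : ℂ) ≤ Z k k := by
    have h := ((le_iff.1 (hXY (x k))).conjTranspose_mul_mul_same
      (U : Matrix (Fin n) (Fin n) ℂ)).diag_nonneg (i := k)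
    rw [← star_eq_conjTranspose] at h
    simp only [mul_sub, sub_mul, mul_add, add_mul, mul_smul_comm, smul_mul_assoc, mul_one,
      hUU, hXU, ← hZdef] at h
    simpa using h
  have hNX : N (CFC.abs X ^ r) = N (diagonal fun k ↦ ((|x k| ^ r : ℝ) : ℂ)) := by
    rw [hX.abs_rpow_eq_cfc (by linarith), hX.cfc_eq, IsHermitian.cfc,
      Unitary.conjStarAlgAut_apply]
    exact hN.map_unitary_mul_mul_unitary _ _ _ U.2 (star U).2
  have hNY : N Z = N Y := hN.map_unitary_mul_mul_unitary _ _ _ (star U).2 U.2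
  have hZre (k) : Z k k = ((Z k k).re : ℂ) :=
    Complex.ext (by simp) (by simpa using ((Complex.le_def.1 (hZ k)).2).symm)
  rw [hNX, ← hNY]
  refine (hN.map_diagonal_mono (e := fun k ↦ (Z k k).re)
    (fun k ↦ Real.rpow_nonneg (abs_nonneg _) _) fun k ↦ ?_).trans
    (le_of_eq_of_le ?_ (hN.map_diagonal_diag_le Z))
  · simpa using (Complex.le_def.1 (hZ k)).1
  · simp only [← hZre]
    rfl
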